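/- For a group $X$ write $X'=[X,X]$, $X''=(X')'$, let $\gamma_1(X)=X$, $\gamma_{i+1}(X)=[\gamma_i(X),X]$ be the lower central series and $1=Z_0(X)\le Z_1(X)\le\cdots$ the upper central series of $X$. Call $X$ residually nilpotent if $\bigcap_{i\ge1}\gamma_i(X)=1$. The Hirsch length $h(X)$ of a polycyclic group $X$ is the number of infinite factors in a finite subnormal series of $X$ with cyclic factors (it does not depend on the series). Let $c\ge 1$ be an integer and let $G,H$ be polycyclic, residually nilpotent groups that are (nilpotent of class at most $c$)-by-abelian, i.e. each has a normal subgroup that is nilpotent of class at most $c$ with abelian quotient. Suppose that $H$ is para-$G$ via $\varphi$, i.e. $\varphi:G\to H$ is an injective homomorphism that induces isomorphisms $G/\gamma_i(G)\to H/\gamma_i(H)$ for all $i\ge 1$. Assume that one of the following holds: (i) $G/G''$ and $H/H''$ are residually nilpotent; (ii) the indices $|Z_{c-1}(G'):G''|$ and $|Z_{c-1}(H'):H''|$ are finite. Then $h(G)=h(H)$. -/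

import Mathlib

/-- A polycyclic series of `G`: a finite subnormal series `1 = G₀ ⊴ G₁ ⊴ ⋯ ⊴ Gₗ = G` all of whose
factors `Gᵢ₊₁ / Gᵢ` are cyclic. (Only the terms with index at most `length` matter.) -/
structure PolycyclicSeries (G : Type*) [Group G] where
  length : ℕ
  term : ℕ → Subgroup G
  term_zero : term 0 = ⊥
  term_length : term length = ⊤
  le_succ : ∀ i < length, term i ≤ term (i + 1)
  normal : ∀ i < length, ((term i).subgroupOf (term (i + 1))).Normal
  cyclic : ∀ (i : ℕ) (hi : i < length),
    haveI := normal i hi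
    IsCyclic (term (i + 1) ⧸ (term i).subgroupOf (term (i + 1)))

/-- The number of infinite (cyclic) factors of a polycyclic series. -/
noncomputable def PolycyclicSeries.infiniteFactors {G : Type*} [Group G]
    (s : PolycyclicSeries G) : ℕ :=
  {i : ℕ | i < s.length ∧
    Infinite (s.term (i + 1) ⧸ (s.term i).subgroupOf (s.term (i + 1)))}.ncard

/-- A group is polycyclic if it has a polycyclic series. -/
def IsPolycyclic (G : Type*) [Group G] : Prop :=
  Nonempty (PolycyclicSeries G)

/-- The Hirsch length of a polycyclic group: the number of infinite factors in a polycyclic series.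
That number does not depend on the series, so the infimum below is taken over a one-point set
whenever `G` is polycyclic. -/
noncomputable def hirschLength (G : Type*) [Group G] : ℕ :=
  sInf (Set.range fun s : PolycyclicSeries G => s.infiniteFactors)

/-- `G` is residually nilpotent: the terms of its lower central series intersect trivially. -/
def IsResiduallyNilpotent (G : Type*) [Group G] : Prop :=
  ⨅ i : ℕ, (⊤ : Subgroup G).lowerCentralSeries i = ⊥

/-- `G` is (nilpotent of class at most `c`)-by-abelian: it has a normal subgroup that is nilpotent of
class at most `c` and whose quotient is abelian. -/
def IsNilpotentByAbelian (c : ℕ) (G : Type*) [Group G] : Prop :=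
  ∃ N : Subgroup G, ∃ _ : N.Normal, Group.IsNilpotent N ∧ Group.nilpotencyClass N ≤ c ∧
    ∀ x y : G ⧸ N, x * y = y * x

/-- The class of polycyclic, residually nilpotent, (nilpotent of class at most `c`)-by-abelian
groups. -/
structure IsPStar (c : ℕ) (G : Type*) [Group G] : Prop where
  polycyclic : IsPolycyclic G
  residuallyNilpotent : IsResiduallyNilpotent G
  nilpotentByAbelian : IsNilpotentByAbelian c G

theorem lowerCentralSeries_le_comap_lowerCentralSeries {G H : Type*} [Group G] [Group H]
    (φ : G →* H) (i : ℕ) :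
    (⊤ : Subgroup G).lowerCentralSeries i ≤ ((⊤ : Subgroup H).lowerCentralSeries i).comap φ := by
  rw [← Subgroup.map_le_iff_le_comap, Subgroup.map_lowerCentralSeries]
  exact Subgroup.lowerCentralSeries_mono i le_top

/-- The homomorphism `G / γᵢ₊₁(G) → H / γᵢ₊₁(H)` induced by `φ : G → H`
(Mathlib's lower central series starts with `γ₁` at index `0`). -/
def lowerCentralQuotientMap {G H : Type*} [Group G] [Group H] (φ : G →* H) (i : ℕ) :
    G ⧸ (⊤ : Subgroup G).lowerCentralSeries i →* H ⧸ (⊤ : Subgroup H).lowerCentralSeries i :=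
  QuotientGroup.map _ _ φ (lowerCentralSeries_le_comap_lowerCentralSeries φ i)

/-- `H` is para-`G` via `φ : G → H`: the homomorphism `φ` is injective and induces isomorphisms
between all corresponding quotients by terms of the lower central series. -/
def IsParaVia {G H : Type*} [Group G] [Group H] (φ : G →* H) : Prop :=
  Function.Injective φ ∧ ∀ i : ℕ, Function.Bijective (lowerCentralQuotientMap φ i)

/-- `|Z_{c-1}(G') : G''| < ∞`, where `G'` is the commutator subgroup of `G`, `Z_j` is the `j`-th term
of the upper central series and `G''` is the commutator subgroup of `G'`; both subgroups are taken
inside `G'`. It is used for groups with `G'' ≤ Z_{c-1}(G')`. -/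
def UpperCentralDerivedFinite (c : ℕ) (G : Type*) [Group G] : Prop :=
  (commutator (commutator G)).IsFiniteRelIndex
    (Subgroup.upperCentralSeries (commutator G) (c - 1))

/-! Let K = φ(G) and N = H'. Surjectivity onto H/γ₃(H) says H = Kγ₃(H), and this already forces |H :
K| to be finite; an injective homomorphism with image of finite index preserves the Hirsch length.

Suppose first that N is abelian. It is a module over the commutative ring ℤ[H/N], finitely generated
as an abelian group, and K ∩ N is a submodule with N = (K ∩ N) + IN for the augmentation ideal I.
Nakayama's lemma gives r ∈ 1 + I with rN ≤ K ∩ N. Residual nilpotence gives ⋂ IⁿN = 0, so r acts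
injectively; hence rN has full rank, thus finite index in N
(`Subgroup.index_ne_zero_of_metabelian`).

In general, take a normal M ≥ H'' with |M : H''| finite and H/M residually nilpotent. The metabelian
case for H/M shows that KM, hence KH'', has finite index. As N is nilpotent, finite index modulo N'
lifts to finite index in N (`Subgroup.index_ne_zero_of_sup_commutator`). Under (i) M = H''; under
(ii) M = Z_{c-1}(H'), where H/M inherits residual nilpotence from H. -/

open scoped commutatorElement

/-! ### Relative indices and cyclic factors -/

/-- If `P ⊆ N * K` and `K` has finite relative index in `N`, then also in `P`. -/
theorem Subgroup.relIndex_ne_zero_of_forall_exists {G : Type*} [Group G] {K N P : Subgroup G}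
    (h : ∀ p ∈ P, ∃ n ∈ N, n⁻¹ * p ∈ K) (hN : K.relIndex N ≠ 0) : K.relIndex P ≠ 0 := by
  have : (K.subgroupOf N).FiniteIndex := ⟨hN⟩
  have hfin : Finite (N ⧸ K.subgroupOf N) := Subgroup.finite_quotient_of_finiteIndex
  choose! f hfN hfK using h
  let F : P ⧸ K.subgroupOf P → N ⧸ K.subgroupOf N := fun q =>
    QuotientGroup.mk ⟨f (q.out : P), hfN _ (q.out : P).2⟩
  have hF : Function.Injective F := by
    intro p q hpq
    rw [← QuotientGroup.out_eq' p, ← QuotientGroup.out_eq' q, QuotientGroup.eq,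
      Subgroup.mem_subgroupOf]
    have h1 : (f (p.out : P))⁻¹ * f (q.out : P) ∈ K := by
      simpa [Subgroup.mem_subgroupOf] using QuotientGroup.eq.1 hpq
    have h2 := K.mul_mem (K.mul_mem (K.inv_mem (hfK _ (p.out : P).2)) h1) (hfK _ (q.out : P).2)
    convert h2 using 1
    push_cast
    group
  have : Finite (P ⧸ K.subgroupOf P) := Finite.of_injective F hF
  exact (Subgroup.finiteIndex_of_finite_quotient (H := K.subgroupOf P)).index_ne_zero

theorem IsCyclic.index_ne_zero {C : Type*} [Group C] [IsCyclic C] {D : Subgroup C} (hD : D ≠ ⊥) :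
    D.index ≠ 0 := by
  let _ : CommGroup C := IsCyclic.commGroup
  obtain ⟨g, hg⟩ := IsCyclic.exists_zpow_surjective (G := C)
  obtain ⟨d, hd⟩ := D.ne_bot_iff_exists_ne_one.1 hD
  obtain ⟨k, hk⟩ := hg d
  have hk0 : k ≠ 0 := by
    rintro rfl
    exact hd (Subtype.ext (by simpa using hk.symm))
  have htor : IsMulTorsion (C ⧸ D) := by
    intro q
    obtain ⟨x, rfl⟩ := QuotientGroup.mk_surjective q
    obtain ⟨m, rfl⟩ := hg x
    refine isOfFinOrder_iff_zpow_eq_one.2 ⟨k, hk0, ?_⟩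
    rw [← QuotientGroup.mk_zpow, QuotientGroup.eq_one_iff]
    simp only at hk ⊢
    rw [zpow_comm, hk]
    exact D.zpow_mem d.2 m
  have : Group.FG C := by
    refine ⟨⟨{g}, ?_⟩⟩
    rw [Finset.coe_singleton, ← Subgroup.zpowers_eq_closure]
    exact (Subgroup.eq_top_iff' _).2 hg
  have : Finite (C ⧸ D) := CommGroup.finite_of_fg_isMulTorsion _ htor
  exact (Subgroup.finiteIndex_of_finite_quotient (H := D)).index_ne_zero

section CyclicFactor

variable {G : Type*} [Group G] {A B : Subgroup G} [(A.subgroupOf B).Normal]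
  [IsCyclic (B ⧸ A.subgroupOf B)]

/-- In a group with a cyclic factor `B / A`, a subgroup `K` of `L` that meets the factor in an
infinite group has finite index in `L ∩ B` as soon as it has finite index in `L ∩ A`. -/
theorem Subgroup.relIndex_inf_ne_zero_of_isCyclic {K L : Subgroup G} (hKL : K ≤ L)
    (hA : K.relIndex (L ⊓ A) ≠ 0) (hK : A.relIndex (K ⊓ B) = 0) :
    K.relIndex (L ⊓ B) ≠ 0 := by
  let q := QuotientGroup.mk' (A.subgroupOf B)
  let D := (K.subgroupOf B).map q
  have hD : D ≠ ⊥ := by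
    intro hD
    have : K ⊓ B ≤ A := by
      rintro x ⟨hxK, hxB⟩
      have : q ⟨x, hxB⟩ ∈ D := ⟨⟨x, hxB⟩, hxK, rfl⟩
      rw [hD, Subgroup.mem_bot] at this
      exact (QuotientGroup.eq_one_iff (N := A.subgroupOf B) (⟨x, hxB⟩ : B)).1 this
    rw [Subgroup.relIndex_eq_one.2 this] at hK
    exact one_ne_zero hK
  -- P is (K ⊓ B)A. It has finite index in B because D is a nontrivial subgroup of a cyclic group,
  -- and elements of P ⊓ L lie in (L ⊓ A)K by the modular law.
  let P := (D.comap q).map B.subtype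
  have hPB : P.relIndex B ≠ 0 := by
    have h1 : P.relIndex B = (D.comap q).index := by
      simp only [Subgroup.relIndex, P]
      congr 1
      exact Subgroup.comap_map_eq_self_of_injective B.subtype_injective _
    rw [h1, Subgroup.index_comap_of_surjective _ (QuotientGroup.mk'_surjective _)]
    exact IsCyclic.index_ne_zero hD
  have hPL : P.relIndex (L ⊓ B) ≠ 0 := fun h =>
    hPB (Subgroup.relIndex_eq_zero_of_le_right inf_le_right h)
  have hK' : K.relIndex (P ⊓ (L ⊓ B)) ≠ 0 := by
    refine Subgroup.relIndex_ne_zero_of_forall_exists (N := L ⊓ A) ?_ hA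
    rintro _ ⟨⟨p, ⟨k, hk, hkp⟩, rfl⟩, hpL, -⟩
    have hkK : (k : G) ∈ K := hk
    refine ⟨p * (k : G)⁻¹, ⟨L.mul_mem hpL (L.inv_mem (hKL hkK)), ?_⟩, by simpa using hkK⟩
    have : q (p * k⁻¹) = 1 := by rw [map_mul, map_inv, hkp, mul_inv_cancel]
    exact (QuotientGroup.eq_one_iff (N := A.subgroupOf B) (p * k⁻¹)).1 this
  have h3 := Subgroup.relIndex_inf_mul_relIndex K P (L ⊓ B)
  exact fun h => mul_ne_zero hK' hPL (h3.trans (Subgroup.relIndex_eq_zero_of_le_left inf_le_left h))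

/-- The image of K in B/A is cyclic, so K ⊓ A and one lift of a generator generate K. -/
theorem Subgroup.fg_of_fg_inf_of_isCyclic {K : Subgroup G} (hK : K ≤ B) (hA : (K ⊓ A).FG) :
    K.FG := by
  let q := QuotientGroup.mk' (A.subgroupOf B)
  obtain ⟨⟨g, ⟨⟨k, hkB⟩, hkK, hkg⟩⟩, hg⟩ :=
    IsCyclic.exists_generator (α := (K.subgroupOf B).map q)
  have hle : K = Subgroup.zpowers k ⊔ (K ⊓ A) := by
    refine le_antisymm (fun x hx => ?_) (sup_le (Subgroup.zpowers_le.2 hkK) inf_le_left)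
    obtain ⟨m, hm⟩ := hg ⟨q ⟨x, hK hx⟩, ⟨⟨x, hK hx⟩, hx, rfl⟩⟩
    have hm' : q (⟨k, hkB⟩ ^ m) = q ⟨x, hK hx⟩ := by
      rw [map_zpow, hkg]
      exact congrArg Subtype.val hm
    have h1 : ((k ^ m)⁻¹ * x) ∈ A := (QuotientGroup.eq (s := A.subgroupOf B)).1 hm'
    have h2 : x = k ^ m * ((k ^ m)⁻¹ * x) := by group
    rw [h2]
    exact Subgroup.mul_mem_sup ⟨m, rfl⟩ ⟨K.mul_mem (K.inv_mem (K.zpow_mem hkK m)) hx, h1⟩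
  rw [hle]
  refine Subgroup.FG.sup ?_ hA
  rw [Subgroup.zpowers_eq_closure]
  exact ⟨{k}, by simp⟩

end CyclicFactor

/-! ### Polycyclic groups and the Hirsch length -/

theorem IsPolycyclic.subgroup_fg {G : Type*} [Group G] (hG : IsPolycyclic G) (K : Subgroup G) :
    K.FG := by
  obtain ⟨s⟩ := hG
  have key : ∀ i ≤ s.length, (K ⊓ s.term i).FG := by
    intro i
    induction i with
    | zero => intro _; rw [s.term_zero, inf_bot_eq]; exact Subgroup.FG.bot
    | succ i ih =>
      intro hi
      have := s.normal i hi
      have := s.cyclic i hi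
      refine Subgroup.fg_of_fg_inf_of_isCyclic (A := s.term i) (B := s.term (i + 1)) inf_le_right ?_
      rw [inf_assoc, inf_eq_right.2 (s.le_succ i hi)]
      exact ih (by omega)
  simpa [s.term_length] using key s.length le_rfl

namespace PolycyclicSeries

variable {G H : Type*} [Group G] [Group H]

open Classical in
/-- The steps of a polycyclic series in which a subgroup `K` has an infinite factor. -/
noncomputable def infiniteSteps (s : PolycyclicSeries G) (K : Subgroup G) : Finset ℕ :=
  {i ∈ Finset.range s.length | (s.term i).relIndex (K ⊓ s.term (i + 1)) = 0}

theorem mem_infiniteSteps {s : PolycyclicSeries G} {K : Subgroup G} {i : ℕ} :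
    i ∈ s.infiniteSteps K ↔ i < s.length ∧ (s.term i).relIndex (K ⊓ s.term (i + 1)) = 0 := by
  simp [infiniteSteps]

theorem infiniteFactors_eq_card (s : PolycyclicSeries G) :
    s.infiniteFactors = (s.infiniteSteps ⊤).card := by
  rw [infiniteFactors, ← Set.ncard_coe_finset]
  congr 1
  ext i
  simp only [Set.mem_ofPred_eq, Finset.mem_coe, mem_infiniteSteps, top_inf_eq]
  rw [Subgroup.relIndex, Subgroup.index_eq_zero_iff_infinite]

theorem infiniteSteps_mono (s : PolycyclicSeries G) {K L : Subgroup G} (h : K ≤ L) :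
    s.infiniteSteps K ⊆ s.infiniteSteps L := by
  intro i
  simp only [mem_infiniteSteps]
  exact fun ⟨hi, h0⟩ => ⟨hi, Subgroup.relIndex_eq_zero_of_le_right (inf_le_inf_right _ h) h0⟩

/-- Climb the series: a finite factor of L changes the index by a finite amount, and where L has an
infinite factor so does K, and a nontrivial subgroup of a cyclic group has finite index. -/
theorem relIndex_ne_zero_of_infiniteSteps_eq (s : PolycyclicSeries G) {K L : Subgroup G}
    (hKL : K ≤ L) (h : s.infiniteSteps L ⊆ s.infiniteSteps K) : K.relIndex L ≠ 0 := by
  have key : ∀ i ≤ s.length, K.relIndex (L ⊓ s.term i) ≠ 0 := by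
    intro i
    induction i with
    | zero => intro _; simp [s.term_zero]
    | succ i ih =>
      intro hi
      have := s.normal i hi
      have := s.cyclic i hi
      by_cases h0 : (s.term i).relIndex (L ⊓ s.term (i + 1)) = 0
      · exact Subgroup.relIndex_inf_ne_zero_of_isCyclic hKL (ih (by omega))
          (mem_infiniteSteps.1 (h (mem_infiniteSteps.2 ⟨hi, h0⟩))).2
      · refine Subgroup.relIndex_ne_zero_trans (ih (by omega)) ?_
        have h1 : L.relIndex (L ⊓ s.term (i + 1)) ≠ 0 := by
          rw [Subgroup.relIndex_eq_one.2 inf_le_left]; exact one_ne_zero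
        exact Subgroup.relIndex_inf_ne_zero h1 h0
  simpa [s.term_length] using key s.length le_rfl

open Classical in
/-- An ascending chain of subgroups has at most as many steps of infinite index as a polycyclic
series has infinite factors. -/
theorem card_le_infiniteFactors (s : PolycyclicSeries G) (C : ℕ → Subgroup G) (n : ℕ)
    (hC : ∀ i < n, C i ≤ C (i + 1)) :
    (Finset.card {i ∈ Finset.range n | (C i).relIndex (C (i + 1)) = 0}) ≤ s.infiniteFactors := by
  have key : ∀ m ≤ n, (Finset.card {i ∈ Finset.range m | (C i).relIndex (C (i + 1)) = 0}) ≤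
      (s.infiniteSteps (C m)).card := by
    intro m
    induction m with
    | zero => simp
    | succ m ih =>
      intro hm
      have ih := ih (by omega)
      have hle := s.infiniteSteps_mono (hC m hm)
      rw [Finset.range_add_one, Finset.filter_insert]
      split_ifs with h0
      · rw [Finset.card_insert_of_notMem (by simp)]
        refine Nat.succ_le_of_lt (lt_of_le_of_lt ih (Finset.card_lt_card ⟨hle, fun h => ?_⟩))
        exact s.relIndex_ne_zero_of_infiniteSteps_eq (hC m hm) h h0
      · exact ih.trans (Finset.card_le_card hle)
  rw [infiniteFactors_eq_card]
  exact (key n le_rfl).trans (Finset.card_le_card (s.infiniteSteps_mono le_top))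

/-- The image of the series is a chain in H with the same step indices. -/
theorem infiniteFactors_le_of_injective (s : PolycyclicSeries G) (t : PolycyclicSeries H)
    {φ : G →* H} (hφ : Function.Injective φ) : s.infiniteFactors ≤ t.infiniteFactors := by
  classical
  have := t.card_le_infiniteFactors (fun i => (s.term i).map φ) s.length
    fun i hi => Subgroup.map_mono (s.le_succ i hi)
  simpa only [Subgroup.relIndex_map_map_of_injective _ _ hφ, infiniteFactors_eq_card,
    infiniteSteps, top_inf_eq] using this

/-- Intersecting with a subgroup of finite index keeps an infinite step infinite, so the pulled back
chain loses none of them. -/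
theorem infiniteFactors_le_of_finiteIndex_range (s : PolycyclicSeries H) (t : PolycyclicSeries G)
    {φ : G →* H} (hφ : φ.range.index ≠ 0) : s.infiniteFactors ≤ t.infiniteFactors := by
  classical
  have := t.card_le_infiniteFactors (fun i => (s.term i).comap φ) s.length
    fun i hi => Subgroup.comap_mono (s.le_succ i hi)
  refine le_trans ?_ this
  rw [infiniteFactors_eq_card]
  refine Finset.card_le_card fun i hi => ?_
  obtain ⟨hi, h0⟩ := mem_infiniteSteps.1 hi
  refine Finset.mem_filter.2 ⟨Finset.mem_range.2 hi, ?_⟩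
  rw [top_inf_eq] at h0
  rw [Subgroup.relIndex_comap, Subgroup.map_comap_eq]
  by_contra h
  have h1 : (φ.range ⊓ s.term (i + 1)).relIndex (s.term (i + 1)) ≠ 0 := by
    rw [Subgroup.inf_relIndex_right]
    exact mt Subgroup.index_eq_zero_of_relIndex_eq_zero hφ
  exact Subgroup.relIndex_ne_zero_trans h h1 h0

end PolycyclicSeries

theorem hirschLength_eq_of_finiteIndex_range {G H : Type*} [Group G] [Group H]
    (hG : IsPolycyclic G) (hH : IsPolycyclic H) {φ : G →* H} (hφ : Function.Injective φ)
    (hfin : φ.range.index ≠ 0) : hirschLength G = hirschLength H := by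
  -- Letting both series vary also yields independence of the series, so each infimum is over a
  -- single value.
  have key (s : PolycyclicSeries G) (t : PolycyclicSeries H) :
      s.infiniteFactors = t.infiniteFactors :=
    le_antisymm (s.infiniteFactors_le_of_injective t hφ)
      (t.infiniteFactors_le_of_finiteIndex_range s hfin)
  obtain ⟨s₀⟩ := hG
  obtain ⟨t₀⟩ := hH
  have h1 : (Set.range fun s : PolycyclicSeries G => s.infiniteFactors) =
      {s₀.infiniteFactors} := by
    refine Set.eq_singleton_iff_unique_mem.2 ⟨⟨s₀, rfl⟩, ?_⟩
    rintro _ ⟨s, rfl⟩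
    exact (key s t₀).trans (key s₀ t₀).symm
  have h2 : (Set.range fun t : PolycyclicSeries H => t.infiniteFactors) =
      {s₀.infiniteFactors} := by
    refine Set.eq_singleton_iff_unique_mem.2 ⟨⟨t₀, (key s₀ t₀).symm⟩, ?_⟩
    rintro _ ⟨t, rfl⟩
    exact (key s₀ t).symm
  rw [hirschLength, hirschLength, h1, h2]

/-! ### Finite index in nilpotent groups -/

/-- If `K * Z` has finite index for a finitely generated central subgroup `Z = [X, N]`, then so
has `K`. -/
theorem Subgroup.index_ne_zero_of_sup_commutator_central {N : Type*} [Group N]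
    (K X : Subgroup N) (hZ : ⁅X, (⊤ : Subgroup N)⁆ ≤ Subgroup.center N)
    (hfg : ⁅X, (⊤ : Subgroup N)⁆.FG) (hK : (K ⊔ ⁅X, ⊤⁆).index ≠ 0) : K.index ≠ 0 := by
  set Z := ⁅X, (⊤ : Subgroup N)⁆ with hZdef
  have hcent : ∀ z ∈ Z, ∀ y, y * z = z * y := fun z hz y => Subgroup.mem_center_iff.1 (hZ hz) y
  have hZn : Z.Normal := ⟨fun z hz g => by rwa [hcent z hz g, mul_inv_cancel_right]⟩
  have hKcomm : ∀ a ∈ K ⊔ Z, ∀ b ∈ K ⊔ Z, ⁅a, b⁆ ∈ K := by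
    intro a ha b hb
    obtain ⟨k, hk, z, hz, rfl⟩ := Subgroup.mem_sup_of_normal_right.1 ha
    obtain ⟨l, hl, w, hw, rfl⟩ := Subgroup.mem_sup_of_normal_right.1 hb
    have : ⁅k * z, l * w⁆ = ⁅k, l⁆ := by
      have e1 : k * z * (l * w) = k * l * (z * w) := by
        rw [mul_assoc, ← mul_assoc z, ← hcent z hz l]; group
      have e2 : l * w * (k * z) = l * k * (z * w) := by
        rw [mul_assoc, ← mul_assoc w, ← hcent w hw k, mul_assoc k, ← hcent w hw z]; group
      rw [commutatorElement_def, mul_assoc, ← mul_inv_rev, e1, e2]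
      group
    rw [this, commutatorElement_def]
    exact K.mul_mem (K.mul_mem (K.mul_mem hk hl) (K.inv_mem hk)) (K.inv_mem hl)
  have hleft : ∀ x ∈ X, ∀ y : N, ∀ n : ℕ, ⁅x ^ n, y⁆ = ⁅x, y⁆ ^ n := by
    intro x hx y n
    have hc : ⁅x, y⁆ ∈ Z := Subgroup.commutator_mem_commutator hx (Subgroup.mem_top y)
    induction n with
    | zero => simp
    | succ n ih =>
      have : ⁅x ^ (n + 1), y⁆ = x * ⁅x ^ n, y⁆ * x⁻¹ * ⁅x, y⁆ := by
        simp only [commutatorElement_def, pow_succ']; group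
      rw [this, ih, hcent _ (Z.pow_mem hc n), mul_inv_cancel_right, pow_succ]
  have hright : ∀ x ∈ X, ∀ y : N, ∀ n : ℕ, ⁅x, y ^ n⁆ = ⁅x, y⁆ ^ n := by
    intro x hx y n
    have hc : ⁅x, y⁆ ∈ Z := Subgroup.commutator_mem_commutator hx (Subgroup.mem_top y)
    induction n with
    | zero => simp
    | succ n ih =>
      have : ⁅x, y ^ (n + 1)⁆ = ⁅x, y⁆ * (y * ⁅x, y ^ n⁆ * y⁻¹) := by
        simp only [commutatorElement_def, pow_succ']; group
      rw [this, ih, hcent _ (Z.pow_mem hc n), mul_inv_cancel_right, pow_succ']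
  -- By bilinearity ⁅x, y⁆ ^ (n * m) = ⁅x ^ m, y ^ n⁆. Suitable powers of x and y lie in KZ, and
  -- commutators of KZ are commutators of K since Z is central.
  have htor : ∀ z ∈ Z, ∃ n : ℕ, 0 < n ∧ z ^ n ∈ K := by
    intro z hz
    rw [hZdef, Subgroup.commutator_def] at hz
    have hle : ∀ w ∈ Subgroup.closure {g | ∃ x ∈ X, ∃ y ∈ (⊤ : Subgroup N), ⁅x, y⁆ = g}, w ∈ Z :=
      fun w hw => hw
    induction hz using Subgroup.closure_induction with
    | mem w hw =>
      obtain ⟨x, hx, y, -, rfl⟩ := hw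
      obtain ⟨m, hm, -, hxm⟩ := Subgroup.exists_pow_mem_of_index_ne_zero hK x
      obtain ⟨n, hn, -, hyn⟩ := Subgroup.exists_pow_mem_of_index_ne_zero hK y
      refine ⟨n * m, Nat.mul_pos hn hm, ?_⟩
      rw [pow_mul, ← hright x hx, ← hleft x hx]
      exact hKcomm _ hxm _ hyn
    | one => exact ⟨1, one_pos, by simp⟩
    | mul a b ha hb iha ihb =>
      obtain ⟨m, hm, ham⟩ := iha
      obtain ⟨n, hn, hbn⟩ := ihb
      refine ⟨m * n, Nat.mul_pos hm hn, ?_⟩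
      have hab : Commute a b := hcent b (hle b hb) a
      rw [hab.mul_pow, pow_mul, mul_comm m n, pow_mul]
      exact K.mul_mem (K.pow_mem ham _) (K.pow_mem hbn _)
    | inv a ha iha =>
      obtain ⟨m, hm, ham⟩ := iha
      exact ⟨m, hm, by rw [inv_pow]; exact K.inv_mem ham⟩
  have hrel : K.relIndex Z ≠ 0 := by
    let _ : CommGroup Z :=
      { (inferInstance : Group Z) with mul_comm := fun a b => Subtype.ext (hcent b b.2 a) }
    have : Group.FG Z := (Group.fg_iff_subgroup_fg Z).2 hfg
    have htor' : IsMulTorsion (Z ⧸ K.subgroupOf Z) := by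
      intro q
      obtain ⟨z, rfl⟩ := QuotientGroup.mk_surjective q
      obtain ⟨n, hn, hzn⟩ := htor z z.2
      refine isOfFinOrder_iff_pow_eq_one.2 ⟨n, hn, ?_⟩
      rw [← QuotientGroup.mk_pow, QuotientGroup.eq_one_iff]
      exact hzn
    have : Finite (Z ⧸ K.subgroupOf Z) := CommGroup.finite_of_fg_isMulTorsion _ htor'
    exact (Subgroup.finiteIndex_of_finite_quotient (H := K.subgroupOf Z)).index_ne_zero
  have h1 : K.relIndex (K ⊔ Z) ≠ 0 := by
    refine Subgroup.relIndex_ne_zero_of_forall_exists (N := Z) (fun p hp => ?_) hrel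
    obtain ⟨k, hk, z, hz, rfl⟩ := Subgroup.mem_sup_of_normal_right.1 hp
    exact ⟨z, hz, by rwa [hcent z hz k, inv_mul_cancel_left]⟩
  rw [← Subgroup.relIndex_top_right] at hK ⊢
  exact Subgroup.relIndex_ne_zero_trans h1 hK

/-- A subgroup of a nilpotent group (with finitely generated subgroups) has finite index if its
image in the abelianization has. -/
theorem Subgroup.index_ne_zero_of_sup_commutator {N : Type*} [Group N] [Group.IsNilpotent N]
    (hfg : ∀ S : Subgroup N, S.FG) {K : Subgroup N} (hK : (K ⊔ _root_.commutator N).index ≠ 0) :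
    K.index ≠ 0 := by
  -- Descend the lower central series: modulo term i + 2, term i + 1 is central and is the
  -- commutator of term i with the whole group.
  have key : ∀ i, (K ⊔ (⊤ : Subgroup N).lowerCentralSeries (i + 1)).index ≠ 0 := by
    intro i
    induction i with
    | zero => rwa [zero_add, Subgroup.top_lowerCentralSeries_one]
    | succ i ih =>
      set W := (⊤ : Subgroup N).lowerCentralSeries (i + 2) with hW
      let q := QuotientGroup.mk' W
      have hq : Function.Surjective q := QuotientGroup.mk'_surjective W
      have hker : q.ker = W := QuotientGroup.ker_mk' W
      have hcomm : ⁅((⊤ : Subgroup N).lowerCentralSeries i).map q, (⊤ : Subgroup (N ⧸ W))⁆ =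
          ((⊤ : Subgroup N).lowerCentralSeries (i + 1)).map q := by
        rw [Subgroup.lowerCentralSeries_succ, Subgroup.map_commutator,
          Subgroup.map_top_of_surjective q hq]
      have hindex : ∀ S : Subgroup N, (S.map q).index = (S ⊔ W).index := by
        intro S
        rw [Subgroup.index_map, hker, MonoidHom.range_eq_top.2 hq, Subgroup.index_top, mul_one]
      have h1 : (K.map q).index ≠ 0 := by
        refine Subgroup.index_ne_zero_of_sup_commutator_central (K.map q)
          (((⊤ : Subgroup N).lowerCentralSeries i).map q) ?_ ?_ ?_
        · rw [hcomm]
          rintro _ ⟨z, hz, rfl⟩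
          refine Subgroup.mem_center_iff.2 fun y => ?_
          obtain ⟨y, rfl⟩ := hq y
          have hzy : ⁅z, y⁆ ∈ W := by
            rw [hW, Subgroup.lowerCentralSeries_succ]
            exact Subgroup.commutator_mem_commutator hz (Subgroup.mem_top y)
          have : q ⁅z, y⁆ = 1 := (QuotientGroup.eq_one_iff _).2 hzy
          rw [map_commutatorElement, commutatorElement_eq_one_iff_mul_comm] at this
          exact this.symm
        · rw [hcomm]
          obtain ⟨S, hS⟩ := hfg ((⊤ : Subgroup N).lowerCentralSeries (i + 1))
          classical
          exact ⟨S.image q, by rw [Finset.coe_image, ← MonoidHom.map_closure, hS]⟩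
        · rw [hcomm, ← Subgroup.map_sup, hindex]
          rwa [sup_assoc, sup_eq_left.2 (Subgroup.lowerCentralSeries_antitone _ (Nat.le_succ _))]
      rwa [hindex] at h1
  obtain ⟨n, hn⟩ := Subgroup.nilpotent_iff_lowerCentralSeries.1 ‹Group.IsNilpotent N›
  have := key n
  rwa [le_bot_iff.1 ((Subgroup.lowerCentralSeries_antitone _ (Nat.le_succ n)).trans hn.le),
    sup_bot_eq] at this

/-! ### The metabelian case by Nakayama's lemma -/

/-- A submodule `B` of a module that is finitely generated as an abelian group has finite index if
it generates the module modulo `I` and the powers of `I` intersect trivially on the module. -/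
theorem Submodule.finite_quotient_of_iInf_pow_smul_eq_bot {R A : Type*} [CommRing R] [AddCommGroup A] [Module R A]
    [Module.Finite ℤ A] (I : Ideal R) (B : Submodule R A)
    (hB : (⊤ : Submodule R A) ≤ B ⊔ I • ⊤)
    (hI : ⨅ n : ℕ, I ^ n • (⊤ : Submodule R A) = ⊥) : Finite (A ⧸ B) := by
  have hfin : Module.Finite R A := by
    exact Module.Finite.of_restrictScalars_finite ℤ R A
  obtain ⟨r, hr, hrB⟩ := Submodule.exists_sub_one_mem_and_smul_le_of_fg_of_le_sup
    (Module.finite_def.1 hfin) le_rfl hB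
  -- If ra = 0 then a = -(r - 1)a with r - 1 ∈ I; iterating puts a in every Iⁿ • ⊤.
  have hinj : ∀ a : A, r • a = 0 → a = 0 := by
    intro a ha
    have key : ∀ n, a ∈ I ^ n • (⊤ : Submodule R A) := by
      intro n
      induction n with
      | zero => simp
      | succ n ih =>
        have : a = -((r - 1) • a) := by rw [sub_smul, ha]; simp
        rw [this, pow_succ', mul_smul]
        exact neg_mem (Submodule.smul_mem_smul hr ih)
    have := (Submodule.mem_iInf _).2 key
    rwa [hI, Submodule.mem_bot] at this
  let f : A →ₗ[ℤ] A := (LinearMap.lsmul R A r).restrictScalars ℤ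
  have hf : Function.Injective f := (injective_iff_map_eq_zero f).2 hinj
  have h1 := Submodule.finrank_quotient_add_finrank (LinearMap.range f)
  rw [LinearMap.finrank_range_of_inj hf] at h1
  have h2 : Module.finrank ℤ (A ⧸ LinearMap.range f) = 0 := by omega
  have h3 : Module.IsTorsion ℤ (A ⧸ LinearMap.range f) :=
    Module.finrank_eq_zero_iff_isTorsion.1 h2
  have h4 : Finite (A ⧸ LinearMap.range f) := Module.finite_of_fg_torsion _ h3
  have hle : LinearMap.range f ≤ B.restrictScalars ℤ := by
    rintro _ ⟨a, rfl⟩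
    exact hrB (Submodule.smul_mem_pointwise_smul a r ⊤ trivial)
  have : Finite (A ⧸ B.restrictScalars ℤ) :=
    Finite.of_surjective _ (Submodule.factor_surjective hle)
  exact this

/-- A version of `Submodule.finite_quotient_of_iInf_pow_smul_eq_bot` for an action of an abelian
group `Q` with a filtration `L` along which `Q` acts unipotently. -/
theorem AddSubgroup.finite_quotient_of_unipotent_filtration {Q A : Type*} [CommGroup Q]
    [AddCommGroup A] [Module.Finite ℤ A] (f : Q →* Module.End ℤ A) (B : AddSubgroup A)
    (hBf : ∀ q, ∀ b ∈ B, f q b ∈ B)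
    (hB : (⊤ : AddSubgroup A) ≤ B ⊔ AddSubgroup.closure {a | ∃ q b, f q b - b = a})
    (L : ℕ → AddSubgroup A) (hLf : ∀ n q, ∀ a ∈ L n, f q a ∈ L n)
    (hLzero : L 0 = ⊤) (hLsucc : ∀ n q, ∀ a ∈ L n, f q a - a ∈ L (n + 1))
    (hL : ⨅ n, L n = ⊥) : Finite (A ⧸ B) := by
  let R := MonoidAlgebra ℤ Q
  let F : R →ₐ[ℤ] Module.End ℤ A := MonoidAlgebra.lift ℤ _ _ f
  let _ : Module R A := Module.compHom A F.toRingHom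
  have hof : ∀ (q : Q) (a : A), (MonoidAlgebra.of ℤ Q q : R) • a = f q a := fun q a =>
    congrArg (fun g : Module.End ℤ A => g a) (MonoidAlgebra.lift_of f q)
  have hsmul (X : AddSubgroup A) (hX : ∀ q, ∀ a ∈ X, f q a ∈ X) (r : R) :
      ∀ a ∈ X, r • a ∈ X := by
    intro a ha
    induction r using MonoidAlgebra.induction_on with
    | of q => rw [hof]; exact hX q a ha
    | add r s hr hs => rw [add_smul]; exact X.add_mem hr hs
    | smul n r hr => rw [smul_assoc]; exact X.zsmul_mem hr n
  let toSub (X : AddSubgroup A) (hX : ∀ q, ∀ a ∈ X, f q a ∈ X) : Submodule R A :=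
    { X with smul_mem' := fun r a ha => hsmul X hX r a ha }
  -- The augmentation ideal; its n-th power carries the module into L n because each q - 1 moves the
  -- filtration one step down.
  let I : Ideal R := Ideal.span {r | ∃ q, MonoidAlgebra.of ℤ Q q - 1 = r}
  have hIL (n : ℕ) : I ^ n • (⊤ : Submodule R A) ≤ toSub (L n) (hLf n) := by
    induction n with
    | zero =>
      intro a _
      change a ∈ L 0
      rw [hLzero]
      trivial
    | succ n ih =>
      rw [pow_succ', Submodule.mul_smul]
      refine Submodule.smul_le.2 fun r hr a ha => ?_
      have ha := ih ha
      induction hr using Submodule.span_induction with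
      | mem r hr =>
        obtain ⟨q, rfl⟩ := hr
        rw [sub_smul, one_smul, hof]
        exact hLsucc n q a ha
      | zero => rw [zero_smul]; exact zero_mem _
      | add r s _ _ hr hs => rw [add_smul]; exact add_mem hr hs
      | smul c r _ hr => rw [smul_assoc]; exact Submodule.smul_mem _ c hr
  refine Submodule.finite_quotient_of_iInf_pow_smul_eq_bot I (toSub B hBf) ?_ ?_
  · have hle : B ⊔ AddSubgroup.closure {a | ∃ q b, f q b - b = a} ≤
        (toSub B hBf ⊔ I • ⊤ : Submodule R A).toAddSubgroup := by
      refine sup_le (fun b hb => Submodule.mem_sup_left hb) ((AddSubgroup.closure_le _).2 ?_)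
      rintro _ ⟨q, b, rfl⟩
      refine Submodule.mem_sup_right ?_
      rw [← hof, ← one_smul R b, smul_smul, mul_one, ← sub_smul]
      exact Submodule.smul_mem_smul (Ideal.subset_span ⟨q, rfl⟩) trivial
    exact fun a _ => hle (hB trivial)
  · refine le_bot_iff.1 fun a ha => ?_
    have : a ∈ ⨅ n, L n :=
      AddSubgroup.mem_iInf.2 fun n => hIL n ((Submodule.mem_iInf _).1 ha n)
    rw [hL] at this
    exact this

/-- Let `H` be a residually nilpotent group whose commutator subgroup is abelian and finitely
generated. Then a subgroup that generates `H` modulo the third term of the lower central series has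
finite index. -/
theorem Subgroup.index_ne_zero_of_metabelian {H : Type*} [Group H]
    (hcomm : ∀ a ∈ _root_.commutator H, ∀ b ∈ _root_.commutator H, a * b = b * a)
    (hfg : (_root_.commutator H).FG) (hres : IsResiduallyNilpotent H)
    (K : Subgroup H) (hK : K ⊔ (⊤ : Subgroup H).lowerCentralSeries 2 = ⊤) : K.index ≠ 0 := by
  set N := _root_.commutator H with hN
  have hN1 : (⊤ : Subgroup H).lowerCentralSeries 1 = N := Subgroup.top_lowerCentralSeries_one
  have h21 : (⊤ : Subgroup H).lowerCentralSeries 2 ≤ N :=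
    (Subgroup.lowerCentralSeries_antitone _ (Nat.le_succ 1)).trans hN1.le
  let _ : CommGroup N :=
    { (inferInstance : Group N) with
      mul_comm := fun a b => Subtype.ext (hcomm a a.2 b b.2) }
  have : Group.FG N := (Group.fg_iff_subgroup_fg N).2 hfg
  have : Module.Finite ℤ (Additive N) := Module.Finite.iff_addGroup_fg.2 inferInstance
  let f₀ : H →* Module.End ℤ (Additive N) :=
    { toFun := fun h =>
        (MonoidHom.toAdditive (MulAut.conjNormal (H := N) h).toMonoidHom).toIntLinearMap
      map_one' := by
        refine LinearMap.ext fun a => ?_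
        change Additive.ofMul (MulAut.conjNormal (H := N) (1 : H) a.toMul) = a
        rw [map_one, MulAut.one_apply, ofMul_toMul]
      map_mul' := fun g h => by
        refine LinearMap.ext fun a => ?_
        change Additive.ofMul (MulAut.conjNormal (H := N) (g * h) a.toMul) =
          Additive.ofMul (MulAut.conjNormal (H := N) g (MulAut.conjNormal (H := N) h a.toMul))
        rw [map_mul, MulAut.mul_apply] }
  have hf₀ (h : H) (a : Additive N) : (((f₀ h a).toMul : N) : H) = h * (a.toMul : N) * h⁻¹ :=
    MulAut.conjNormal_apply h a.toMul
  -- N is abelian, so it acts trivially on itself by conjugation and the action factors through H/N.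
  let f : Abelianization H →* Module.End ℤ (Additive N) := QuotientGroup.lift _ f₀ <| by
    intro h hh
    refine LinearMap.ext fun a => Additive.toMul.injective (Subtype.ext ?_)
    rw [hf₀, hcomm h hh _ a.toMul.2, mul_inv_cancel_right]
    rfl
  let B : AddSubgroup (Additive N) := Subgroup.toAddSubgroup (K.subgroupOf N)
  have hB (a : Additive N) : a ∈ B ↔ ((a.toMul : N) : H) ∈ K := Iff.rfl
  -- The shift makes L 0 all of N: index n + 1 is γₙ₊₂(H).
  let L (n : ℕ) : AddSubgroup (Additive N) :=
    Subgroup.toAddSubgroup (((⊤ : Subgroup H).lowerCentralSeries (n + 1)).subgroupOf N)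
  have hL (n : ℕ) (a : Additive N) :
      a ∈ L n ↔ ((a.toMul : N) : H) ∈ (⊤ : Subgroup H).lowerCentralSeries (n + 1) := Iff.rfl
  have hdecomp (h : H) : ∃ k ∈ K, ∃ g ∈ (⊤ : Subgroup H).lowerCentralSeries 2, k * g = h :=
    Subgroup.mem_sup_of_normal_right.1 (by rw [hK]; trivial)
  have hfin : Finite (Additive N ⧸ B) := by
    refine AddSubgroup.finite_quotient_of_unipotent_filtration f B ?_ ?_ L ?_ ?_ ?_ ?_
    · intro q b hb
      obtain ⟨h, rfl⟩ := QuotientGroup.mk_surjective q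
      -- Write h = kg with g ∈ γ₃(H) ≤ N: g acts trivially, and k normalizes K ∩ N.
      obtain ⟨k, hk, g, hg, rfl⟩ := hdecomp h
      change f₀ (k * g) b ∈ B
      rw [hB] at hb ⊢
      rw [hf₀]
      have : k * g * (b.toMul : N) * (k * g)⁻¹ = k * (b.toMul : N) * k⁻¹ := by
        rw [mul_assoc k g, hcomm g (h21 hg) _ b.toMul.2]
        group
      rw [this]
      exact K.mul_mem (K.mul_mem hk hb) (K.inv_mem hk)
    · set C := AddSubgroup.closure {a | ∃ q b, f q b - b = a} with hC
      -- γ₃(H) = [N, H] is generated by the commutators ⁅x, y⁆, which are additively x - y·x and so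
      -- lie in IN.
      have hle : (⊤ : Subgroup H).lowerCentralSeries 2 ≤
          (AddSubgroup.toSubgroup' C).map N.subtype := by
        rw [Subgroup.lowerCentralSeries_succ, hN1, Subgroup.commutator_le]
        intro x hx y _
        have hmem : f (Abelianization.of y) (Additive.ofMul ⟨x, hx⟩) -
            Additive.ofMul ⟨x, hx⟩ ∈ C := AddSubgroup.subset_closure ⟨_, _, rfl⟩
        refine ⟨_, C.neg_mem hmem, ?_⟩
        rw [neg_sub]
        change x / ((f₀ y (Additive.ofMul ⟨x, hx⟩)).toMul : N) = ⁅x, y⁆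
        rw [hf₀, commutatorElement_def]
        change x / (y * x * y⁻¹) = _
        rw [div_eq_mul_inv]
        group
      intro a _
      obtain ⟨k, hk, g, hg, hkg⟩ := hdecomp (a.toMul : N)
      obtain ⟨c, hc, hcg⟩ := hle hg
      have hkN : k ∈ N := by
        rw [← mul_inv_eq_iff_eq_mul.2 hkg.symm]
        exact N.mul_mem a.toMul.2 (N.inv_mem (h21 hg))
      have : a = Additive.ofMul ⟨k, hkN⟩ + Additive.ofMul c := by
        refine Additive.toMul.injective (Subtype.ext ?_)
        rw [← hkg, ← hcg]
        rfl
      rw [this]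
      exact AddSubgroup.add_mem_sup hk hc
    · intro n q a ha
      obtain ⟨h, rfl⟩ := QuotientGroup.mk_surjective q
      change f₀ h a ∈ L n
      rw [hL] at ha ⊢
      rw [hf₀]
      exact Subgroup.Normal.conj_mem inferInstance _ ha h
    · refine (AddSubgroup.eq_top_iff' _).2 fun a => ?_
      rw [hL, zero_add, hN1]
      exact a.toMul.2
    · intro n q a ha
      obtain ⟨h, rfl⟩ := QuotientGroup.mk_surjective q
      change f₀ h a - a ∈ L (n + 1)
      rw [hL] at ha ⊢
      change ((f₀ h a).toMul : H) / ((a.toMul : N) : H) ∈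
        (⊤ : Subgroup H).lowerCentralSeries (n + 1 + 1)
      rw [hf₀, div_eq_mul_inv, Subgroup.lowerCentralSeries_succ, ← commutatorElement_def, ← commutatorElement_inv]
      exact inv_mem (Subgroup.commutator_mem_commutator ha (Subgroup.mem_top h))
    · refine le_bot_iff.1 fun a ha => ?_
      have ha' : ((a.toMul : N) : H) ∈ ⨅ i, (⊤ : Subgroup H).lowerCentralSeries i := by
        refine Subgroup.mem_iInf.2 fun i => ?_
        exact Subgroup.lowerCentralSeries_antitone _ (Nat.le_succ i)
          ((hL i a).1 (AddSubgroup.mem_iInf.1 ha i))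
      rw [hres, Subgroup.mem_bot] at ha'
      exact Subtype.ext ha'
  have hrel : K.relIndex N ≠ 0 := by
    have h1 : B.index ≠ 0 :=
      (AddSubgroup.finiteIndex_of_finite_quotient (H := B)).index_ne_zero
    rwa [Subgroup.index_toAddSubgroup] at h1
  rw [← Subgroup.relIndex_top_right]
  refine Subgroup.relIndex_ne_zero_of_forall_exists (fun p _ => ?_) hrel
  -- Decomposing p⁻¹ instead of p puts the factor from N on the left of p.
  obtain ⟨k, hk, g, hg, hkg⟩ := hdecomp p⁻¹
  refine ⟨g⁻¹, N.inv_mem (h21 hg), ?_⟩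
  rw [← inv_inv p, ← hkg]
  simpa using hk

/-! ### Reduction to a metabelian quotient -/

/-- Let `H` be a group with nilpotent commutator subgroup, all of whose subgroups are finitely
generated, and let `M` be a normal subgroup containing `H''` with `|M : H''|` finite and
`H / M` residually nilpotent. Then a subgroup that generates `H` modulo the third term of the lower
central series has finite index. -/
theorem Subgroup.index_ne_zero_of_residuallyNilpotent_quotient {H : Type*} [Group H]
    (hfg : ∀ S : Subgroup H, S.FG) [Group.IsNilpotent (_root_.commutator H)]
    (M : Subgroup H) [M.Normal]
    (hM : ⁅_root_.commutator H, _root_.commutator H⁆ ≤ M)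
    (hfin : ⁅_root_.commutator H, _root_.commutator H⁆.relIndex M ≠ 0)
    (hres : IsResiduallyNilpotent (H ⧸ M)) (K : Subgroup H)
    (hK : K ⊔ (⊤ : Subgroup H).lowerCentralSeries 2 = ⊤) : K.index ≠ 0 := by
  let q := QuotientGroup.mk' M
  have hq : Function.Surjective q := QuotientGroup.mk'_surjective M
  set N := _root_.commutator H with hN
  have hqN : _root_.commutator (H ⧸ M) = N.map q := by
    rw [hN, _root_.commutator_def, _root_.commutator_def, Subgroup.map_commutator,
      Subgroup.map_top_of_surjective q hq]
  have hKM : (K ⊔ M).index ≠ 0 := by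
    have h1 : (K.map q).index ≠ 0 := by
      refine Subgroup.index_ne_zero_of_metabelian ?_ ?_ hres _ ?_
      · rw [hqN]
        rintro _ ⟨a, ha, rfl⟩ _ ⟨b, hb, rfl⟩
        rw [← commutatorElement_eq_one_iff_mul_comm, ← map_commutatorElement]
        exact (QuotientGroup.eq_one_iff _).2
          (hM (Subgroup.commutator_mem_commutator ha hb))
      · rw [hqN]
        obtain ⟨S, hS⟩ := hfg N
        classical
        exact ⟨S.image q, by rw [Finset.coe_image, ← MonoidHom.map_closure, hS]⟩
      · rw [← Subgroup.map_top_of_surjective q hq, ← Subgroup.map_lowerCentralSeries,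
          ← Subgroup.map_sup, hK]
    rwa [Subgroup.index_map, QuotientGroup.ker_mk', MonoidHom.range_eq_top.2 hq,
      Subgroup.index_top, mul_one] at h1
  have hNN : (⁅N, N⁆ : Subgroup H).Normal := inferInstance
  have hKN : (K ⊔ ⁅N, N⁆).index ≠ 0 := by
    have h1 : (K ⊔ ⁅N, N⁆).relIndex (K ⊔ M) ≠ 0 := by
      refine Subgroup.relIndex_ne_zero_of_forall_exists (N := M) (fun p hp => ?_)
        fun h => hfin (Subgroup.relIndex_eq_zero_of_le_left le_sup_right h)
      obtain ⟨m, hm, k, hk, rfl⟩ := Subgroup.mem_sup_of_normal_left.1 (sup_comm K M ▸ hp)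
      exact ⟨m, hm, by rw [inv_mul_cancel_left]; exact Subgroup.mem_sup_left hk⟩
    rw [← Subgroup.relIndex_top_right] at hKM ⊢
    exact Subgroup.relIndex_ne_zero_trans h1 hKM
  have hmap : (_root_.commutator N).map N.subtype = ⁅N, N⁆ := by
    rw [_root_.commutator_def, Subgroup.map_commutator, ← MonoidHom.range_eq_map, Subgroup.range_subtype]
  have hrel : K.relIndex N ≠ 0 := by
    refine Subgroup.index_ne_zero_of_sup_commutator (N := N) ?_ ?_
    · intro S
      have : Group.FG (S.map N.subtype) := (Group.fg_iff_subgroup_fg _).2 (hfg _)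
      exact (Group.fg_iff_subgroup_fg S).1 (Group.fg_of_surjective
        (f := (S.equivMapOfInjective _ N.subtype_injective).symm.toMonoidHom)
        (S.equivMapOfInjective _ N.subtype_injective).symm.surjective)
    · have h1 : (K ⊔ ⁅N, N⁆).relIndex N ≠ 0 :=
        mt Subgroup.index_eq_zero_of_relIndex_eq_zero hKN
      -- Modular law: KN' ∩ N = (K ∩ N)N', since N' ≤ N.
      refine fun h => h1 (Nat.eq_zero_of_zero_dvd (h ▸ Subgroup.index_dvd_of_le ?_))
      intro x hx
      obtain ⟨k, hk, m, hm, hkm⟩ := Subgroup.mem_sup_of_normal_right.1 (Subgroup.mem_subgroupOf.1 hx)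
      rw [← hmap] at hm
      obtain ⟨m, hm, rfl⟩ := hm
      have hkN : k ∈ N := by
        rw [← mul_inv_eq_iff_eq_mul.2 hkm.symm]
        exact N.mul_mem x.2 (N.inv_mem m.2)
      have : x = ⟨k, hkN⟩ * m := Subtype.ext hkm.symm
      rw [this]
      exact Subgroup.mul_mem_sup hk hm
  rw [← Subgroup.relIndex_top_right]
  refine Subgroup.relIndex_ne_zero_of_forall_exists (fun p _ => ?_) hrel
  have hp : p⁻¹ ∈ K ⊔ (⊤ : Subgroup H).lowerCentralSeries 2 := by rw [hK]; trivial
  obtain ⟨k, hk, g, hg, hkg⟩ := Subgroup.mem_sup_of_normal_right.1 hp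
  have hgN : g ∈ N := by
    rw [hN, ← Subgroup.top_lowerCentralSeries_one]
    exact Subgroup.lowerCentralSeries_antitone _ (Nat.le_succ 1) hg
  refine ⟨g⁻¹, N.inv_mem hgN, ?_⟩
  rw [← inv_inv p, ← hkg]
  simpa using hk

/-! ### Residual nilpotence modulo upper central terms -/

/-- In a residually nilpotent group, an element that lies, modulo every term of the lower central
series, in a term of the upper central series of the commutator subgroup lies in that term. -/
theorem mem_upperCentralSeries_of_forall_mem_sup {H : Type*} [Group H]
    (hres : IsResiduallyNilpotent H) (j : ℕ) (g : H)
    (hg : ∀ i, g ∈ (Subgroup.upperCentralSeries (commutator H) j).map (commutator H).subtype ⊔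
      (⊤ : Subgroup H).lowerCentralSeries i) :
    g ∈ (Subgroup.upperCentralSeries (commutator H) j).map (commutator H).subtype := by
  induction j generalizing g with
  | zero =>
    rw [Subgroup.upperCentralSeries_zero, Subgroup.map_bot] at *
    rw [← hres]
    exact Subgroup.mem_iInf.2 fun i => by simpa using hg i
  | succ j ih =>
    have hgN : g ∈ commutator H := by
      refine (sup_le (Subgroup.map_subtype_le _) ?_) (hg 1)
      rw [Subgroup.top_lowerCentralSeries_one]
    refine ⟨⟨g, hgN⟩, Subgroup.mem_upperCentralSeries_succ_iff.2 fun y => ?_, rfl⟩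
    -- If g = zu with z ∈ Z_{j+1}(H') and u in term i, then ⁅g, y⁆ is a conjugate of ⁅u, y⁆ times
    -- ⁅z, y⁆, hence lies in Z_j(H') times term i.
    have key := ih ⁅g, (y : H)⁆ fun i => ?_
    · obtain ⟨z, hz, hzg⟩ := key
      have : z = ⁅(⟨g, hgN⟩ : commutator H), y⁆ := Subtype.ext hzg
      rw [← this]
      exact hz
    · obtain ⟨_, ⟨z, hz, rfl⟩, u, hu, rfl⟩ := Subgroup.mem_sup_of_normal_right.1 (hg i)
      have h1 : ⁅z, y⁆ ∈ Subgroup.upperCentralSeries (commutator H) j :=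
        Subgroup.mem_upperCentralSeries_succ_iff.1 hz y
      have h2 : ⁅u, (y : H)⁆ ∈ (⊤ : Subgroup H).lowerCentralSeries i :=
        Subgroup.lowerCentralSeries_antitone _ (Nat.le_succ i) <| by
          rw [Subgroup.lowerCentralSeries_succ]
          exact Subgroup.commutator_mem_commutator hu (Subgroup.mem_top _)
      have h3 : ⁅(z : H) * u, (y : H)⁆ = (z * ⁅u, (y : H)⁆ * (z : H)⁻¹) * (⁅z, y⁆ : commutator H) := by
        have : ((⁅z, y⁆ : commutator H) : H) = ⁅(z : H), (y : H)⁆ := rfl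
        rw [this]
        simp only [commutatorElement_def]
        group
      change ⁅(z : H) * u, (y : H)⁆ ∈ _
      rw [h3]
      exact mul_mem (Subgroup.mem_sup_right (Subgroup.Normal.conj_mem inferInstance _ h2 _))
        (Subgroup.mem_sup_left ⟨_, h1, rfl⟩)

/-- The lower central series of H/M is the image of that of H, so the hypothesis says that M is
closed in the topology given by the lower central series. -/
theorem IsResiduallyNilpotent.quotient {H : Type*} [Group H] (M : Subgroup H) [M.Normal]
    (h : ∀ g, (∀ i, g ∈ M ⊔ (⊤ : Subgroup H).lowerCentralSeries i) → g ∈ M) :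
    IsResiduallyNilpotent (H ⧸ M) := by
  refine le_bot_iff.1 fun x hx => ?_
  obtain ⟨g, rfl⟩ := QuotientGroup.mk'_surjective M x
  refine (QuotientGroup.eq_one_iff g).2 (h g fun i => ?_)
  have hi := Subgroup.mem_iInf.1 hx i
  rw [← Subgroup.map_top_of_surjective _ (QuotientGroup.mk'_surjective M),
    ← Subgroup.map_lowerCentralSeries] at hi
  have : g ∈ (((⊤ : Subgroup H).lowerCentralSeries i).map (QuotientGroup.mk' M)).comap
    (QuotientGroup.mk' M) := hi
  rwa [Subgroup.comap_map_eq, QuotientGroup.ker_mk', sup_comm] at this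

/-- The commutator subgroup of a (nilpotent of class at most `c`)-by-abelian group is nilpotent of
class at most `c`. -/
theorem IsNilpotentByAbelian.upperCentralSeries_eq_top {c : ℕ} {H : Type*} [Group H]
    (h : IsNilpotentByAbelian c H) : Subgroup.upperCentralSeries (commutator H) c = ⊤ := by
  obtain ⟨N, hN, hnil, hc, hab⟩ := h
  have hle : commutator H ≤ N := by
    rw [commutator_def, Subgroup.commutator_le]
    intro x _ y _
    rw [← QuotientGroup.eq_one_iff (N := N)]
    change QuotientGroup.mk' N ⁅x, y⁆ = 1
    rw [map_commutatorElement, commutatorElement_eq_one_iff_mul_comm]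
    exact hab _ _
  have hbot := Subgroup.lowerCentralSeries_eq_bot_iff_nilpotencyClass_le.2 hc
  rw [← Subgroup.lowerCentralSeries_eq_bot_iff_upperCentralSeries_eq_top]
  have h1 : ((⊤ : Subgroup (commutator H)).lowerCentralSeries c).map (Subgroup.inclusion hle) ≤
      (⊤ : Subgroup N).lowerCentralSeries c := by
    rw [Subgroup.map_lowerCentralSeries]
    exact Subgroup.lowerCentralSeries_mono c le_top
  rw [hbot, le_bot_iff, Subgroup.map_eq_bot_iff_of_injective _ (Subgroup.inclusion_injective hle)]
    at h1
  exact h1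

/-! ### The image of φ has finite index -/

theorem theorem3p4 {G H : Type*} [Group G] [Group H] (c : ℕ) (hc : 1 ≤ c)
    (hG : IsPStar c G) (hH : IsPStar c H) (φ : G →* H) (hφ : IsParaVia φ)
    (h : (IsResiduallyNilpotent (G ⧸ derivedSeries G 2) ∧
            IsResiduallyNilpotent (H ⧸ derivedSeries H 2)) ∨
          (UpperCentralDerivedFinite c G ∧ UpperCentralDerivedFinite c H)) :
    hirschLength G = hirschLength H := by
  refine hirschLength_eq_of_finiteIndex_range hG.polycyclic hH.polycyclic hφ.1 ?_
  -- Index 2 is γ₃(H).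
  have hrange : φ.range ⊔ (⊤ : Subgroup H).lowerCentralSeries 2 = ⊤ := by
    refine (Subgroup.eq_top_iff' _).2 fun x => ?_
    obtain ⟨y, hy⟩ := (hφ.2 2).2 (QuotientGroup.mk x)
    obtain ⟨g, rfl⟩ := QuotientGroup.mk_surjective y
    have h1 : (φ g)⁻¹ * x ∈ (⊤ : Subgroup H).lowerCentralSeries 2 := QuotientGroup.eq.1 hy
    rw [← mul_inv_cancel_left (φ g) x]
    exact Subgroup.mul_mem_sup ⟨g, rfl⟩ h1
  have htop := hH.nilpotentByAbelian.upperCentralSeries_eq_top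
  have : Group.IsNilpotent (commutator H) := ⟨c, htop⟩
  rcases h with ⟨-, h⟩ | ⟨-, h⟩
  · have h2 : derivedSeries H 2 = ⁅commutator H, commutator H⁆ := by
      rw [derivedSeries_succ, derivedSeries_one]
    refine Subgroup.index_ne_zero_of_residuallyNilpotent_quotient hH.polycyclic.subgroup_fg
      (derivedSeries H 2) h2.ge ?_ h _ hrange
    rw [← h2, Subgroup.relIndex_self]; exact one_ne_zero
  · set N := commutator H with hN
    have hmap : (commutator N).map N.subtype = ⁅N, N⁆ := by
      rw [commutator_def, Subgroup.map_commutator, ← MonoidHom.range_eq_map,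
        Subgroup.range_subtype]
    -- Z_c(N) = N, so commutators with N fall into Z_{c-1}(N); c ≥ 1 keeps the subtraction honest.
    have hle : commutator N ≤ Subgroup.upperCentralSeries N (c - 1) := by
      rw [commutator_def, Subgroup.commutator_le]
      intro x _ y _
      have hx : x ∈ Subgroup.upperCentralSeries N (c - 1 + 1) := by
        rw [Nat.sub_add_cancel hc, htop]; trivial
      exact Subgroup.mem_upperCentralSeries_succ_iff.1 hx y
    refine Subgroup.index_ne_zero_of_residuallyNilpotent_quotient hH.polycyclic.subgroup_fg
      ((Subgroup.upperCentralSeries N (c - 1)).map N.subtype) ?_ ?_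
      (.quotient _ fun g hg =>
        mem_upperCentralSeries_of_forall_mem_sup hH.residuallyNilpotent _ g hg) _ hrange
    · rw [← hN, ← hmap]; exact Subgroup.map_mono hle
    · rw [← hN, ← hmap, Subgroup.relIndex_map_map_of_injective _ _ N.subtype_injective]
      exact h.relIndex_ne_zero
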